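/- Let $n\ge 0$ and let $\Omega\subset\mathbb C^n$ be an open set. For open $U\subset\mathbb C^n$ let $A(U)$ denote the set of holomorphic functions on $U$. Consider pairs of open sets $\Omega_1,\Omega_2\subset\mathbb C^n$ such that (a) $\emptyset\neq\Omega_1\subset\Omega_2\cap\Omega$, and (b) $\Omega_2$ is connected and not contained in $\Omega$. The set $\Omega$ is called a domain of holomorphy if there are no open sets $\Omega_1,\Omega_2$ satisfying (a), (b) and such that for every $u\in A(\Omega)$ there is $u_2\in A(\Omega_2)$ with $u=u_2$ on $\Omega_1$. For a compact set $K\subset\Omega$ put $$\hat K=\{z\in\Omega:\ |f(z)|\le\sup_K|f|\ \text{ for all } f\in A(\Omega)\},$$ where the supremum over the empty set is $0$, and for $L\subset\Omega$ let $d(L)\in[0,\infty]$ be the supremum of all $r\ge 0$ such that the Euclidean ball $B(z,r)$ is contained in $\Omega$ for all $z\in L$. Then the following conditions are equivalent: (i) $\Omega$ is a domain of holomorphy. (ii) If $K$ is a compact subset of $\Omega$, then $\hat K$ is a compact subset of $\Omega$ and $d(\hat K)=d(K)$. (iii) If $K$ is a compact subset of $\Omega$, then $\hat K$ is also a compact subset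 of $\Omega$. (iv) There exists a function $f\in A(\Omega)$ such that it is not possible to find open sets $\Omega_1$ and $\Omega_2$ satisfying (a) and (b) and a function $f_2\in A(\Omega_2)$ such that $f=f_2$ on $\Omega_1$. -/

import Mathlib

open scoped NNReal ENNReal

namespace SeveralComplexVariables

variable {n : ℕ}

/-- `A(Ω)`: the functions that are holomorphic on `Ω`. A function on `Ω` is represented by any of
its extensions to the whole space; the values outside `Ω` play no role. -/
def A (Ω : Set (EuclideanSpace ℂ (Fin n))) : Set (EuclideanSpace ℂ (Fin n) → ℂ) :=
  {f | DifferentiableOn ℂ f Ω}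

/-- `Ω₁` and `Ω₂` are open sets such that
(a) `∅ ≠ Ω₁ ⊆ Ω₂ ∩ Ω`, and (b) `Ω₂` is connected and not contained in `Ω`. -/
structure IsContinuationPair (Ω Ω₁ Ω₂ : Set (EuclideanSpace ℂ (Fin n))) : Prop where
  isOpen_left : IsOpen Ω₁
  isOpen_right : IsOpen Ω₂
  nonempty : Ω₁.Nonempty
  subset_inter : Ω₁ ⊆ Ω₂ ∩ Ω
  isConnected : IsConnected Ω₂
  not_subset : ¬ Ω₂ ⊆ Ω

/-- The open set `Ω` is a domain of holomorphy: there is no pair `Ω₁`, `Ω₂` with (a) and (b) such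
that every `u ∈ A(Ω)` agrees on `Ω₁` with some `u₂ ∈ A(Ω₂)`. -/
def IsDomainOfHolomorphy (Ω : Set (EuclideanSpace ℂ (Fin n))) : Prop :=
  IsOpen Ω ∧ ¬ ∃ Ω₁ Ω₂ : Set (EuclideanSpace ℂ (Fin n)), IsContinuationPair Ω Ω₁ Ω₂ ∧
    ∀ u ∈ A Ω, ∃ u₂ ∈ A Ω₂, Set.EqOn u u₂ Ω₁

/-- The `A(Ω)`-hull of `K`: all `z ∈ Ω` with `|f(z)| ≤ sup_K |f|` for every `f ∈ A(Ω)`.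
(For compact `K ⊆ Ω` the supremum is over a bounded set; over `K = ∅` it is `0`.) -/
def holomorphicHull (Ω K : Set (EuclideanSpace ℂ (Fin n))) : Set (EuclideanSpace ℂ (Fin n)) :=
  {z | z ∈ Ω ∧ ∀ f ∈ A Ω, ‖f z‖ ≤ sSup ((fun w => ‖f w‖) '' K)}

/-- The boundary distance `d(L)` of `L` in `Ω`: the supremum in `[0, ∞]` of all radii `r` such
that the Euclidean ball `B(z, r)` is contained in `Ω` for all `z ∈ L`. -/
noncomputable def boundaryDist (Ω L : Set (EuclideanSpace ℂ (Fin n))) : ℝ≥0∞ :=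
  ⨆ (r : ℝ≥0) (_ : ∀ z ∈ L, Metric.ball z (r : ℝ) ⊆ Ω), (r : ℝ≥0∞)

end SeveralComplexVariables

namespace SeveralComplexVariables

/-! ### Holomorphic functions of several variables, by restriction to complex lines -/

section Calculus

open Metric Filter Topology

variable {E F : Type*} [NormedAddCommGroup E] [NormedSpace ℂ E]
  [NormedAddCommGroup F] [NormedSpace ℂ F]

/-! The implications (ii) → (iii) and (iv) → (i) are formal: a function without continuation defeats
every pair at once.

(i) → (ii): let the `r`-balls about `K` lie in `Ω`, and let `r' < r`. Cauchy's estimates bound the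
Taylor terms of `u ∈ A Ω` uniformly for centres in `K` and increments of norm at most `r'`. These
terms are holomorphic in the centre, so the bounds pass to the hull, and the Taylor series of `u` at
a hull point converges on the `r'`-ball. If the `r`-ball there left `Ω`, some such `r'`-ball would
continue all of `A Ω` (`ball_subset_of_mem_holomorphicHull`).

(iii) → (iv): the largest ball in `Ω` about a point leaves every compact hull, so some function is
tiny on a given compact set and huge somewhere in the ball. Summing such corrections gives `f`
unbounded on the largest ball about each point of a dense sequence (`exists_unbounded_on_balls`). A
continuation would be bounded near some point outside `Ω`, and a whole such ball fits into that
neighbourhood (`not_continuable_of_unbounded_on_balls`). -/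

theorem differentiable_line (x v : E) : Differentiable ℂ fun t : ℂ => x + t • v := by fun_prop

theorem hasDerivAt_comp_line {f : E → F} {x v : E} {t : ℂ} {f' : E →L[ℂ] F}
    (hf : HasFDerivAt f f' (x + t • v)) :
    HasDerivAt (fun t : ℂ => f (x + t • v)) (f' v) t := by
  have hl : HasDerivAt (fun t : ℂ => x + t • v) v t := by
    simpa using ((hasDerivAt_id t).smul_const v).const_add x
  exact hf.comp_hasDerivAt t hl

theorem line_mem_ball {x v : E} {R S : ℝ} (h : S * ‖v‖ ≤ R) {t : ℂ} (ht : ‖t‖ < S)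
    (hR : 0 < R) : x + t • v ∈ ball x R := by
  rw [mem_ball, dist_eq_norm, add_sub_cancel_left, norm_smul]
  rcases eq_or_ne v 0 with rfl | hv
  · simpa using hR
  · exact (mul_lt_mul_of_pos_right ht (norm_pos_iff.2 hv)).trans_le h

/-- Cauchy's estimate for the Fréchet derivative. -/
theorem norm_fderiv_le_of_ball {f : E → F} {x : E} {r R C : ℝ} (hr : 0 < r) (hrR : r < R)
    (hf : DifferentiableOn ℂ f (ball x R)) (hC : ∀ y ∈ ball x R, ‖f y‖ ≤ C) :
    ‖fderiv ℂ f x‖ ≤ C / r := by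
  have hR : 0 < R := hr.trans hrR
  have hC0 : 0 ≤ C := (norm_nonneg _).trans (hC x (mem_ball_self hR))
  refine ContinuousLinearMap.opNorm_le_bound _ (by positivity) fun v => ?_
  rcases eq_or_ne v 0 with rfl | hv
  · simp
  have hv' : 0 < ‖v‖ := norm_pos_iff.2 hv
  have hmem : ∀ t ∈ closedBall (0 : ℂ) (r / ‖v‖), x + t • v ∈ ball x R := fun t ht => by
    rw [mem_closedBall_zero_iff, le_div_iff₀ hv'] at ht
    rw [mem_ball, dist_eq_norm, add_sub_cancel_left, norm_smul]
    exact ht.trans_lt hrR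
  have hd : DifferentiableOn ℂ (fun t : ℂ => f (x + t • v)) (closedBall 0 (r / ‖v‖)) :=
    hf.comp (differentiable_line x v).differentiableOn hmem
  have h := Complex.norm_deriv_le_of_forall_mem_sphere_norm_le (c := 0) (C := C)
    (f := fun t : ℂ => f (x + t • v)) (div_pos hr hv') (hd.diffContOnCl_ball subset_rfl)
    (fun t ht => hC _ (hmem t (sphere_subset_closedBall ht)))
  have hfx : HasFDerivAt f (fderiv ℂ f x) (x + (0 : ℂ) • v) := by
    simpa using (hf.differentiableAt (ball_mem_nhds x hR)).hasFDerivAt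
  rw [(hasDerivAt_comp_line hfx).deriv] at h
  rwa [div_div_eq_mul_div, mul_div_right_comm] at h

/-- A series of holomorphic functions with a summable uniform bound has a holomorphic sum. -/
theorem differentiableOn_tsum_of_ball [CompleteSpace F] {f : ℕ → E → F} {C : ℕ → ℝ} {x : E}
    {R : ℝ} (hC : Summable C) (hf : ∀ k, DifferentiableOn ℂ (f k) (ball x R))
    (hb : ∀ k, ∀ y ∈ ball x R, ‖f k y‖ ≤ C k) :
    DifferentiableOn ℂ (fun y => ∑' k, f k y) (ball x R) := by
  intro y hy
  obtain ⟨s, hs, hsub⟩ : ∃ s > 0, ball y s ⊆ ball x R :=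
    Metric.isOpen_iff.1 isOpen_ball y hy
  have hsub' : ∀ z ∈ ball y (s / 2), ball z (s / 2) ⊆ ball x R := fun z hz w hw => hsub <| by
    rw [mem_ball] at *
    linarith [dist_triangle w z y]
  let _ : NormedSpace ℝ E := NormedSpace.restrictScalars ℝ ℂ E
  -- Cauchy's estimate needs a radius strictly below `s / 2`; `s / 4` serves.
  refine (hasFDerivAt_tsum_of_isPreconnected (u := fun k => C k / (s / 4))
    (f' := fun k z => fderiv ℂ (f k) z) (hC.div_const _)
    isOpen_ball (convex_ball y (s / 2)).isPreconnected (fun k z hz => ?_) (fun k z hz => ?_)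
    (mem_ball_self (half_pos hs)) ?_ (mem_ball_self
      (half_pos hs))).differentiableAt.differentiableWithinAt
  · exact ((hf k).differentiableAt (isOpen_ball.mem_nhds
      (hsub' z hz (mem_ball_self (half_pos hs))))).hasFDerivAt
  · exact norm_fderiv_le_of_ball (by positivity) (by linarith) ((hf k).mono (hsub' z hz))
      fun w hw => hb k w (hsub' z hz hw)
  · exact .of_norm_bounded hC fun k => hb k y hy

/-- A limit of holomorphic functions with summable uniform bounds on the increments is
holomorphic. -/
theorem differentiableOn_of_tendsto_of_ball [CompleteSpace F] {f : ℕ → E → F} {g : E → F}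
    {C : ℕ → ℝ} {x : E} {R : ℝ} (hC : Summable C)
    (hf : ∀ k, DifferentiableOn ℂ (f k) (ball x R))
    (hb : ∀ k, ∀ y ∈ ball x R, ‖f (k + 1) y - f k y‖ ≤ C k)
    (hg : ∀ y ∈ ball x R, Tendsto (fun k => f k y) atTop (𝓝 (g y))) :
    DifferentiableOn ℂ g (ball x R) := by
  refine ((differentiableOn_tsum_of_ball (f := fun k y => f (k + 1) y - f k y) hC
    (fun k => (hf (k + 1)).sub (hf k)) hb).add (hf 0)).congr fun y hy => ?_
  have hs : Summable fun k => f (k + 1) y - f k y := .of_norm_bounded hC fun k => hb k y hy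
  have h1 := hs.hasSum.tendsto_sum_nat
  simp only [Finset.sum_range_sub (fun k => f k y)] at h1
  have h2 := (hg y hy).sub_const (f 0 y)
  rw [Pi.add_apply, tendsto_nhds_unique h1 h2, sub_add_cancel]

/-- Uniform convergence of difference quotients of a bounded holomorphic function. -/
theorem norm_slope_sub_deriv_le [CompleteSpace F] {g : ℂ → F} {R M : ℝ} (hR : 0 < R)
    (hg : DifferentiableOn ℂ g (ball 0 R)) (hM : ∀ t ∈ ball (0 : ℂ) R, ‖g t‖ ≤ M)
    {h : ℂ} (hh : h ∈ ball 0 R) (h0 : h ≠ 0) :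
    ‖h⁻¹ • (g h - g 0) - deriv g 0‖ ≤ (2 * ((2 * M + 1) / R) + 1) / R * ‖h‖ := by
  have h0R : (0 : ℂ) ∈ ball (0 : ℂ) R := mem_ball_self hR
  have hmaps : Set.MapsTo g (ball 0 R) (ball (g 0) (2 * M + 1)) := fun t ht => by
    rw [mem_ball, dist_eq_norm]
    linarith [norm_sub_le (g t) (g 0), hM t ht, hM 0 h0R]
  have hb : ∀ t ∈ ball (0 : ℂ) R, ‖dslope g 0 t‖ ≤ (2 * M + 1) / R := fun t ht =>
    Complex.norm_dslope_le_div_of_mapsTo_ball hg (hmaps.mono_right ball_subset_closedBall) ht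
  have hd : DifferentiableOn ℂ (dslope g 0) (ball 0 R) :=
    (Complex.differentiableOn_dslope (ball_mem_nhds _ hR)).2 hg
  have hmaps' : Set.MapsTo (dslope g 0) (ball 0 R)
      (closedBall (dslope g 0 0) (2 * ((2 * M + 1) / R) + 1)) := fun t ht => by
    rw [mem_closedBall, dist_eq_norm]
    linarith [norm_sub_le (dslope g 0 t) (dslope g 0 0), hb t ht, hb 0 h0R]
  -- Second use of the Schwarz lemma: the first bounds `dslope g 0`, this one makes its deviation
  -- from `deriv g 0` linear in `h`.
  have key := Complex.dist_le_div_mul_dist_of_mapsTo_ball hd hmaps' hh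
  rwa [dslope_same, dslope_of_ne _ h0, slope_def_module, sub_zero, dist_eq_norm,
    dist_zero_right] at key

/-- The directional derivative is a locally uniform limit of difference quotients, which are
holomorphic in the base point. -/
theorem differentiableOn_fderiv_apply [CompleteSpace F] {f : E → F} {Ω : Set E} (hΩ : IsOpen Ω)
    (hf : DifferentiableOn ℂ f Ω) (v : E) :
    DifferentiableOn ℂ (fun z => fderiv ℂ f z v) Ω := by
  intro x hx
  obtain ⟨s, hs, hsub⟩ : ∃ s > 0, ball x s ⊆ Ω ∩ {z | ‖f z‖ < ‖f x‖ + 1} := by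
    refine Metric.mem_nhds_iff.1 (inter_mem (hΩ.mem_nhds hx) ?_)
    exact (hf.continuousOn.continuousAt (hΩ.mem_nhds hx)).norm.eventually_lt
      continuousAt_const (lt_add_one _)
  set R : ℝ := s / 2 / (‖v‖ + 1) with hRdef
  have hR : 0 < R := by positivity
  have hRv : R * ‖v‖ ≤ s / 2 := by
    rw [hRdef, div_mul_eq_mul_div, div_le_iff₀ (by positivity)]
    nlinarith [norm_nonneg v]
  have hmem : ∀ z ∈ ball x (s / 2), ∀ t ∈ ball (0 : ℂ) R, z + t • v ∈ ball x s :=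
    fun z hz t ht => by
      have := line_mem_ball (x := z) hRv (mem_ball_zero_iff.1 ht) (half_pos hs)
      rw [mem_ball] at *
      linarith [dist_triangle (z + t • v) z x]
  -- Geometric steps turn the error `O(‖h k‖)` into a summable one.
  set h : ℕ → ℂ := fun k => ((R / 2 * (1 / 2) ^ k : ℝ) : ℂ) with hh
  have hnorm : ∀ k, ‖h k‖ = R / 2 * (1 / 2) ^ k := fun k => by
    rw [hh, Complex.norm_real, Real.norm_of_nonneg (by positivity)]
  have hh0 : ∀ k, h k ≠ 0 := fun k => norm_pos_iff.1 (by rw [hnorm]; positivity)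
  have hhR : ∀ k, h k ∈ ball (0 : ℂ) R := fun k => by
    rw [mem_ball_zero_iff, hnorm]
    have : (1 / 2 : ℝ) ^ k ≤ 1 := pow_le_one₀ (by norm_num) (by norm_num)
    nlinarith
  set C : ℝ := (2 * ((2 * (‖f x‖ + 1) + 1) / R) + 1) / R
  have key : ∀ k, ∀ z ∈ ball x (s / 2),
      ‖(h k)⁻¹ • (f (z + h k • v) - f z) - fderiv ℂ f z v‖ ≤ C * (R / 2 * (1 / 2) ^ k) := by
    intro k z hz
    have hd : DifferentiableOn ℂ (fun t : ℂ => f (z + t • v)) (ball 0 R) :=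
      hf.comp (differentiable_line z v).differentiableOn fun t ht => (hsub (hmem z hz t ht)).1
    have hzx : z ∈ ball x s := ball_subset_ball (by linarith) hz
    have hfz : HasFDerivAt f (fderiv ℂ f z) (z + (0 : ℂ) • v) := by
      simpa using (hf.differentiableAt (hΩ.mem_nhds (hsub hzx).1)).hasFDerivAt
    have := norm_slope_sub_deriv_le hR hd (fun t ht => (hsub (hmem z hz t ht)).2.le) (hhR k)
      (hh0 k)
    rw [(hasDerivAt_comp_line hfz).deriv, hnorm] at this
    simpa using this
  have hgeo : Summable fun k : ℕ => C * (R / 2 * (1 / 2 : ℝ) ^ k) :=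
    ((summable_geometric_of_lt_one (by norm_num) (by norm_num)).mul_left _).mul_left _
  refine ((differentiableOn_of_tendsto_of_ball (R := s / 2) (x := x)
    (f := fun k z => (h k)⁻¹ • (f (z + h k • v) - f z))
    (((summable_nat_add_iff 1).2 hgeo).add hgeo) (fun k => ?_) (fun k z hz => ?_)
    (fun z hz => ?_)).differentiableAt (ball_mem_nhds x (half_pos hs))).differentiableWithinAt
  · refine DifferentiableOn.const_smul (DifferentiableOn.sub ?_ ?_) _
    · exact hf.comp (by fun_prop) fun z hz => (hsub (hmem z hz _ (hhR k))).1
    · exact hf.mono fun z hz => (hsub (ball_subset_ball (by linarith) hz)).1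
  · refine (norm_sub_le_norm_sub_add_norm_sub _ (fderiv ℂ f z v) _).trans ?_
    rw [norm_sub_rev (fderiv ℂ f z v)]
    exact add_le_add (key (k + 1) z hz) (key k z hz)
  · exact tendsto_iff_norm_sub_tendsto_zero.2 (squeeze_zero (fun _ => norm_nonneg _)
      (fun k => key k z hz) hgeo.tendsto_atTop_zero)

/-- Directional derivatives are again holomorphic, and in finite dimension smoothness of the
derivative can be tested on vectors. -/
theorem contDiffOn_of_differentiableOn [FiniteDimensional ℂ E] [CompleteSpace F] {f : E → F}
    {Ω : Set E} (hΩ : IsOpen Ω) (hf : DifferentiableOn ℂ f Ω) (k : ℕ) :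
    ContDiffOn ℂ k f Ω := by
  induction k generalizing f with
  | zero => exact contDiffOn_zero.2 hf.continuousOn
  | succ k ih =>
    refine (contDiffOn_succ_iff_fderiv_of_isOpen hΩ).2 ⟨hf, fun h => absurd h (WithTop.natCast_ne_top k), ?_⟩
    exact contDiffOn_clm_apply.2 fun v => ih (differentiableOn_fderiv_apply hΩ hf v)

/-- The identity theorem for holomorphic functions on connected open sets. -/
theorem eqOn_of_isPreconnected [CompleteSpace F] {f g : E → F} {V U : Set E} (hV : IsOpen V)
    (hVc : IsPreconnected V) (hf : DifferentiableOn ℂ f V) (hg : DifferentiableOn ℂ g V)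
    (hU : IsOpen U) (hUV : (U ∩ V).Nonempty) (hfg : Set.EqOn f g (U ∩ V)) :
    Set.EqOn f g V := by
  have hsub : V ⊆ {z | f =ᶠ[𝓝 z] g} := by
    refine hVc.subset_of_closure_inter_subset isOpen_setOfPred_eventually_nhds ?_ ?_
    · obtain ⟨z, hz⟩ := hUV
      exact ⟨z, hz.2, Filter.eventually_of_mem ((hU.inter hV).mem_nhds hz) hfg⟩
    · rintro x ⟨hx, hxV⟩
      obtain ⟨s, hs, hsV⟩ := Metric.isOpen_iff.1 hV x hxV
      obtain ⟨y, hy, hyx⟩ := Metric.mem_closure_iff.1 hx s hs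
      refine Filter.eventually_of_mem (ball_mem_nhds x hs) fun w hw => ?_
      let _ : NormedSpace ℝ E := NormedSpace.restrictScalars ℝ ℂ E
      -- The complex line through `y` (at `0`) and `w` (at `1`) meets the ball in a convex set, so
      -- the one-variable identity theorem applies.
      set l : ℂ → E := fun t => y + t • (w - y) with hl
      have hld : Differentiable ℂ l := differentiable_line _ _
      have hyb : y ∈ ball x s := by rwa [mem_ball, dist_comm]
      have hconv : Convex ℝ (l ⁻¹' ball x s) := by
        intro a ha b hb p q hp hq hpq
        have : l (p • a + q • b) = p • l a + q • l b := by
          have hpq' : (p : ℂ) + q = 1 := by exact_mod_cast hpq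
          have hE : ∀ (p : ℝ) (e : E), p • e = (p : ℂ) • e := fun _ _ => rfl
          simp only [hl, hE, Complex.real_smul, smul_add, smul_smul, add_smul]
          have : y = (p : ℂ) • y + (q : ℂ) • y := by rw [← add_smul, hpq', one_smul]
          nth_rewrite 1 [this]
          abel
        rw [Set.mem_preimage, this]
        exact convex_ball x s ha hb hp hq hpq
      have hopen : IsOpen (l ⁻¹' ball x s) := isOpen_ball.preimage hld.continuous
      have hmaps : Set.MapsTo l (l ⁻¹' ball x s) V := fun t ht => hsV ht
      have h1 : AnalyticOnNhd ℂ (f ∘ l) (l ⁻¹' ball x s) :=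
        (hf.comp hld.differentiableOn hmaps).analyticOnNhd hopen
      have h2 : AnalyticOnNhd ℂ (g ∘ l) (l ⁻¹' ball x s) :=
        (hg.comp hld.differentiableOn hmaps).analyticOnNhd hopen
      have h0 : l 0 = y := by simp [hl]
      have hev : f ∘ l =ᶠ[𝓝 0] g ∘ l := by
        have : Tendsto l (𝓝 0) (𝓝 y) := h0 ▸ hld.continuous.tendsto 0
        exact this.eventually hy
      have := h1.eqOn_of_preconnected_of_eventuallyEq h2 hconv.isPreconnected
        (show (0 : ℂ) ∈ l ⁻¹' ball x s by rwa [Set.mem_preimage, h0]) hev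
        (show (1 : ℂ) ∈ l ⁻¹' ball x s by simpa [hl] using hw)
      simpa [hl] using this
  exact fun z hz => (hsub hz).self_of_nhds

/-! ### Taylor expansion in homogeneous terms -/

/-- The homogeneous Taylor terms of a function of several variables. -/
noncomputable def taylorTerm (f : E → F) (k : ℕ) (z v : E) : F :=
  (k.factorial : ℂ)⁻¹ • iteratedFDeriv ℂ k f z fun _ => v

theorem taylorTerm_smul (f : E → F) (k : ℕ) (z v : E) (c : ℂ) :
    taylorTerm f k z (c • v) = c ^ k • taylorTerm f k z v := by
  have := (iteratedFDeriv ℂ k f z).map_smul_univ (fun _ => c) (fun _ => v)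
  rw [taylorTerm, taylorTerm, this, smul_comm]
  simp

theorem differentiable_taylorTerm (f : E → F) (k : ℕ) (z : E) :
    Differentiable ℂ (taylorTerm f k z) := by
  have : Differentiable ℂ fun v : E => iteratedFDeriv ℂ k f z fun _ => v :=
    ((iteratedFDeriv ℂ k f z).contDiff (n := 1)).differentiable one_ne_zero |>.comp (by fun_prop)
  exact this.const_smul _

theorem differentiableOn_taylorTerm [FiniteDimensional ℂ E] [CompleteSpace F] {f : E → F}
    {Ω : Set E} (hΩ : IsOpen Ω) (hf : DifferentiableOn ℂ f Ω) (k : ℕ) (v : E) :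
    DifferentiableOn ℂ (fun z => taylorTerm f k z v) Ω := by
  have h : DifferentiableOn ℂ (iteratedFDeriv ℂ k f) Ω := fun z hz =>
    (((contDiffOn_of_differentiableOn hΩ hf (k + 1)).contDiffAt
      (hΩ.mem_nhds hz)).differentiableAt_iteratedFDeriv (by
        exact_mod_cast Nat.lt_succ_self k)).differentiableWithinAt
  have h' : DifferentiableOn ℂ (fun z => iteratedFDeriv ℂ k f z fun _ => v) Ω :=
    (ContinuousMultilinearMap.apply ℂ (fun _ : Fin k => E) F
      fun _ => v).differentiable.comp_differentiableOn h
  exact h'.const_smul _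

theorem iteratedDeriv_line [FiniteDimensional ℂ E] [CompleteSpace F] {f : E → F} {Ω : Set E}
    (hΩ : IsOpen Ω) (hf : DifferentiableOn ℂ f Ω) (x v : E) (k : ℕ) : ∀ t : ℂ, x + t • v ∈ Ω →
    iteratedDeriv k (fun t : ℂ => f (x + t • v)) t =
      iteratedFDeriv ℂ k f (x + t • v) fun _ => v := by
  induction k with
  | zero => simp
  | succ k ih =>
    intro t ht
    have hev : iteratedDeriv k (fun t : ℂ => f (x + t • v)) =ᶠ[𝓝 t]
        fun t => iteratedFDeriv ℂ k f (x + t • v) fun _ => v :=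
      Filter.eventually_of_mem ((hΩ.preimage
        (differentiable_line x v).continuous).mem_nhds ht) ih
    rw [iteratedDeriv_succ, hev.deriv_eq, iteratedFDeriv_succ_apply_left]
    have h := (((contDiffOn_of_differentiableOn hΩ hf (k + 1)).contDiffAt
      (hΩ.mem_nhds ht)).differentiableAt_iteratedFDeriv (m := k) (by
        exact_mod_cast Nat.lt_succ_self k)).hasFDerivAt
    have h2 := (ContinuousMultilinearMap.apply ℂ (fun _ : Fin k => E) F
      fun _ => v).hasFDerivAt.comp_hasDerivAt t (hasDerivAt_comp_line h)
    exact h2.deriv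

theorem taylorTerm_eq_iteratedDeriv [FiniteDimensional ℂ E] [CompleteSpace F] {f : E → F}
    {Ω : Set E} (hΩ : IsOpen Ω) (hf : DifferentiableOn ℂ f Ω) {x : E} (hx : x ∈ Ω) (v : E)
    (k : ℕ) : taylorTerm f k x v =
      (k.factorial : ℂ)⁻¹ • iteratedDeriv k (fun t : ℂ => f (x + t • v)) 0 := by
  rw [iteratedDeriv_line hΩ hf x v k 0 (by simpa using hx), taylorTerm]
  simp

/-- Cauchy's estimate on the unit disc for the slice `t ↦ f (x + t • v)`. -/
theorem norm_taylorTerm_le [FiniteDimensional ℂ E] [CompleteSpace F] {f : E → F}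
    {Ω : Set E} (hΩ : IsOpen Ω) (hf : DifferentiableOn ℂ f Ω) {x : E} {r M : ℝ}
    (hr : closedBall x r ⊆ Ω) (hM : ∀ y ∈ closedBall x r, ‖f y‖ ≤ M) {v : E} (hv : ‖v‖ ≤ r)
    (k : ℕ) : ‖taylorTerm f k x v‖ ≤ M := by
  have hmem : ∀ t ∈ closedBall (0 : ℂ) 1, x + t • v ∈ closedBall x r := fun t ht => by
    rw [mem_closedBall_zero_iff] at ht
    rw [mem_closedBall, dist_eq_norm, add_sub_cancel_left, norm_smul]
    exact (mul_le_of_le_one_left (norm_nonneg v) ht).trans hv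
  have hx : x ∈ Ω := hr (mem_closedBall_self ((norm_nonneg v).trans hv))
  have hd : DifferentiableOn ℂ (fun t : ℂ => f (x + t • v)) (closedBall 0 1) :=
    hf.comp (differentiable_line x v).differentiableOn fun t ht => hr (hmem t ht)
  have h := Complex.norm_iteratedDeriv_le_of_forall_mem_sphere_norm_le k one_pos
    (hd.diffContOnCl_ball subset_rfl) (fun t ht => hM _ (hmem t (sphere_subset_closedBall ht)))
  rw [taylorTerm_eq_iteratedDeriv hΩ hf hx, norm_smul, norm_inv, RCLike.norm_natCast,
    inv_mul_le_iff₀ (by positivity)]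
  simpa using h

/-- The slice along `v` is holomorphic on a disc of radius above `1`; its Taylor series is evaluated
at `t = 1`. -/
theorem hasSum_taylorTerm [FiniteDimensional ℂ E] [CompleteSpace F] {f : E → F}
    {x : E} {r : ℝ} (hf : DifferentiableOn ℂ f (ball x r)) {v : E} (hv : ‖v‖ < r) :
    HasSum (fun k => taylorTerm f k x v) (f (x + v)) := by
  have hr : 0 < r := (norm_nonneg v).trans_lt hv
  obtain ⟨R, hR1, hRv⟩ : ∃ R : ℝ, 1 < R ∧ R * ‖v‖ ≤ r := by
    rcases eq_or_ne v 0 with rfl | hv0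
    · exact ⟨2, by norm_num, by simpa using hr.le⟩
    · have hv' : 0 < ‖v‖ := norm_pos_iff.2 hv0
      exact ⟨r / ‖v‖, (one_lt_div hv').2 hv, (div_mul_cancel₀ _ hv'.ne').le⟩
  have hd : DifferentiableOn ℂ (fun t : ℂ => f (x + t • v)) (ball 0 R) :=
    hf.comp (differentiable_line x v).differentiableOn fun t ht =>
      line_mem_ball hRv (mem_ball_zero_iff.1 ht) hr
  have h := Complex.hasSum_taylorSeries_on_ball hd
    (show (1 : ℂ) ∈ ball (0 : ℂ) R by simpa using hR1)
  simpa [taylorTerm_eq_iteratedDeriv isOpen_ball hf (mem_ball_self hr)] using h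

end Calculus

section CartanThullen

open Metric Filter Topology
open scoped Pointwise

variable {n : ℕ} {Ω K : Set (EuclideanSpace ℂ (Fin n))}

/-! ### Hulls, and (i) → (ii) -/

theorem subset_holomorphicHull (hK : IsCompact K) (hKΩ : K ⊆ Ω) : K ⊆ holomorphicHull Ω K :=
  fun _ hz => ⟨hKΩ hz, fun _ hf => le_csSup
    (hK.bddAbove_image ((DifferentiableOn.continuousOn hf).mono hKΩ).norm)
    (Set.mem_image_of_mem _ hz)⟩

theorem norm_le_of_mem_holomorphicHull {f : EuclideanSpace ℂ (Fin n) → ℂ} (hf : f ∈ A Ω) {M : ℝ}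
    (hM0 : 0 ≤ M) (hM : ∀ w ∈ K, ‖f w‖ ≤ M) {z : EuclideanSpace ℂ (Fin n)}
    (hz : z ∈ holomorphicHull Ω K) : ‖f z‖ ≤ M :=
  -- `0 ≤ M` covers empty `K`, where the supremum is `0`.
  (hz.2 f hf).trans <| Real.sSup_le (by rintro _ ⟨w, hw, rfl⟩; exact hM w hw) hM0

/-- The coordinate functions belong to `A Ω`. -/
theorem isBounded_holomorphicHull (Ω K : Set (EuclideanSpace ℂ (Fin n))) :
    Bornology.IsBounded (holomorphicHull Ω K) := by
  refine isBounded_iff_forall_norm_le.2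
    ⟨√(∑ i, (sSup ((fun w : EuclideanSpace ℂ (Fin n) => ‖w i‖) '' K)) ^ 2), fun z hz => ?_⟩
  rw [EuclideanSpace.norm_eq]
  refine Real.sqrt_le_sqrt (Finset.sum_le_sum fun i _ => ?_)
  have hi : (fun w : EuclideanSpace ℂ (Fin n) => w i) ∈ A Ω :=
    (EuclideanSpace.proj i : EuclideanSpace ℂ (Fin n) →L[ℂ] ℂ).differentiable.differentiableOn
  exact pow_le_pow_left₀ (norm_nonneg _) (hz.2 _ hi) 2

/-- A holomorphic function bounded on the closed `r`-balls around points of `K` has a Taylor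
series at every point of the hull of `K` that converges on the `r`-ball. -/
theorem differentiableOn_tsum_taylorTerm {ζ : EuclideanSpace ℂ (Fin n)} (hΩ : IsOpen Ω)
    (hζ : ζ ∈ holomorphicHull Ω K) {r M : ℝ} (hr : 0 < r) (hM0 : 0 ≤ M)
    (hKr : ∀ w ∈ K, closedBall w r ⊆ Ω) {u : EuclideanSpace ℂ (Fin n) → ℂ} (hu : u ∈ A Ω)
    (hM : ∀ w ∈ K, ∀ y ∈ closedBall w r, ‖u y‖ ≤ M) :
    DifferentiableOn ℂ (fun y => ∑' k, taylorTerm u k ζ (y - ζ)) (ball ζ r) := by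
  have hbound : ∀ k v, ‖v‖ ≤ r → ‖taylorTerm u k ζ v‖ ≤ M := fun k v hv =>
    norm_le_of_mem_holomorphicHull (f := fun z => taylorTerm u k z v)
      (differentiableOn_taylorTerm hΩ hu k v) hM0
      (fun w hw => norm_taylorTerm_le hΩ hu (hKr w hw) (hM w hw) hv k) hζ
  intro y hy
  obtain ⟨s, hys, hsr⟩ := exists_between (mem_ball.1 hy)
  have hs : 0 < s := dist_nonneg.trans_lt hys
  refine ((differentiableOn_tsum_of_ball (x := ζ) (R := s) (C := fun k => (s / r) ^ k * M)
    ((summable_geometric_of_lt_one (by positivity) ((div_lt_one hr).2 hsr)).mul_right M)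
    (fun k => ((differentiable_taylorTerm u k ζ).comp
      (differentiable_id.sub_const ζ)).differentiableOn) fun k z hz => ?_).differentiableAt
      (isOpen_ball.mem_nhds hys)).differentiableWithinAt
  -- Stretching the increment by `r / s` keeps its norm at most `r`, and homogeneity yields the
  -- geometric factor `(s / r) ^ k`.
  have hz' : z - ζ = ((s / r : ℝ) : ℂ) • ((r / s : ℝ) : ℂ) • (z - ζ) := by
    rw [smul_smul, ← Complex.ofReal_mul, div_mul_div_cancel₀ hr.ne', div_self hs.ne',
      Complex.ofReal_one, one_smul]
  simp only [Function.comp_apply, id]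
  rw [hz', taylorTerm_smul, norm_smul, norm_pow, Complex.norm_real,
    Real.norm_of_nonneg (by positivity)]
  refine mul_le_mul_of_nonneg_left (hbound k _ ?_) (by positivity)
  rw [norm_smul, Complex.norm_real, Real.norm_of_nonneg (by positivity), ← dist_eq_norm,
    div_mul_eq_mul_div, div_le_iff₀ hs]
  exact mul_le_mul_of_nonneg_left (mem_ball.1 hz).le hr.le

theorem ball_subset_of_mem_holomorphicHull (hD : IsDomainOfHolomorphy Ω) (hK : IsCompact K)
    {r : ℝ} (hr : ∀ w ∈ K, ball w r ⊆ Ω) {ζ : EuclideanSpace ℂ (Fin n)}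
    (hζ : ζ ∈ holomorphicHull Ω K) : ball ζ r ⊆ Ω := by
  intro p hp
  by_contra hpΩ
  -- The smaller radius still reaches `p`, and the closed `r'`-neighbourhood of `K` is compact in
  -- `Ω`, so each `u` is bounded on it.
  obtain ⟨r', hpr, hr'r⟩ := exists_between (mem_ball.1 hp)
  have hr' : 0 < r' := dist_nonneg.trans_lt hpr
  obtain ⟨ρ, hρ, hρsub⟩ : ∃ ρ > 0, ball ζ ρ ⊆ ball ζ r' ∩ Ω :=
    Metric.mem_nhds_iff.1 (inter_mem (ball_mem_nhds ζ hr') (hD.1.mem_nhds hζ.1))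
  have hKr : ∀ w ∈ K, closedBall w r' ⊆ Ω := fun w hw =>
    (closedBall_subset_ball hr'r).trans (hr w hw)
  let _ : NormedSpace ℝ (EuclideanSpace ℂ (Fin n)) := NormedSpace.restrictScalars ℝ ℂ _
  refine hD.2 ⟨ball ζ ρ, ball ζ r', ⟨isOpen_ball, isOpen_ball, ⟨ζ, mem_ball_self hρ⟩, hρsub,
    ⟨⟨ζ, mem_ball_self hr'⟩, (convex_ball ζ r').isPreconnected⟩, fun h => hpΩ (h hpr)⟩,
    fun u hu => ⟨fun y => ∑' k, taylorTerm u k ζ (y - ζ), ?_, fun y hy => ?_⟩⟩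
  · have hL : IsCompact (K + closedBall (0 : EuclideanSpace ℂ (Fin n)) r') :=
      hK.add (isCompact_closedBall 0 r')
    have hmem : ∀ w ∈ K, ∀ y ∈ closedBall w r',
        y ∈ K + closedBall (0 : EuclideanSpace ℂ (Fin n)) r' := fun w hw y hy =>
      ⟨w, hw, y - w, by rwa [mem_closedBall_zero_iff, ← dist_eq_norm], by simp⟩
    have hLΩ : K + closedBall (0 : EuclideanSpace ℂ (Fin n)) r' ⊆ Ω := by
      rintro _ ⟨w, hw, v, hv, rfl⟩
      exact hKr w hw (by simpa using hv)
    obtain ⟨M, hM⟩ := hL.exists_bound_of_continuousOn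
      ((DifferentiableOn.continuousOn hu).mono hLΩ)
    exact differentiableOn_tsum_taylorTerm hD.1 hζ hr' (le_max_right M 0) hKr hu
      fun w hw y hy => (hM y (hmem w hw y hy)).trans (le_max_left _ _)
  · have h := (hasSum_taylorTerm (DifferentiableOn.mono hu fun z hz => (hρsub hz).2)
      (show ‖y - ζ‖ < ρ by rwa [← dist_eq_norm])).tsum_eq
    simpa using h.symm

theorem isCompact_holomorphicHull (hD : IsDomainOfHolomorphy Ω) (hK : IsCompact K)
    (hKΩ : K ⊆ Ω) : IsCompact (holomorphicHull Ω K) := by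
  refine isCompact_of_isClosed_isBounded ?_ (isBounded_holomorphicHull Ω K)
  obtain ⟨δ, hδ, hδΩ⟩ := hK.exists_thickening_subset_open hD.1 hKΩ
  refine isClosed_of_closure_subset fun z hz => ?_
  -- The `δ`-balls about hull points lie in `Ω`, so the hull cannot accumulate at the boundary.
  have hzΩ : z ∈ Ω := by
    obtain ⟨y, hy, hzy⟩ := Metric.mem_closure_iff.1 hz δ hδ
    exact ball_subset_of_mem_holomorphicHull hD hK
      (fun w hw => (ball_subset_thickening hw δ).trans hδΩ) hy hzy
  refine ⟨hzΩ, fun f hf => ?_⟩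
  obtain ⟨y, hy, hlim⟩ := mem_closure_iff_seq_limit.1 hz
  exact le_of_tendsto (((DifferentiableOn.continuousOn hf).continuousAt
    (hD.1.mem_nhds hzΩ)).norm.tendsto.comp hlim) (.of_forall fun k => (hy k).2 f hf)

theorem boundaryDist_holomorphicHull (hD : IsDomainOfHolomorphy Ω) (hK : IsCompact K)
    (hKΩ : K ⊆ Ω) : boundaryDist Ω (holomorphicHull Ω K) = boundaryDist Ω K :=
  le_antisymm
    (iSup₂_mono' fun r hr => ⟨r, fun z hz => hr z (subset_holomorphicHull hK hKΩ hz), le_rfl⟩)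
    (iSup₂_mono' fun r hr => ⟨r, fun _ hz => ball_subset_of_mem_holomorphicHull hD hK hr hz,
      le_rfl⟩)

/-! ### Construction of an unbounded function for (iii) → (iv) -/

theorem ball_infDist_compl_subset {ζ : EuclideanSpace ℂ (Fin n)} :
    ball ζ (infDist ζ Ωᶜ) ⊆ Ω := fun y hy => by
  by_contra hyΩ
  rw [mem_ball, dist_comm] at hy
  exact (infDist_le_dist_of_mem (s := Ωᶜ) hyΩ).not_gt hy

theorem infDist_compl_pos (hΩ : IsOpen Ω) (hne : Ωᶜ.Nonempty) {ζ : EuclideanSpace ℂ (Fin n)}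
    (hζ : ζ ∈ Ω) : 0 < infDist ζ Ωᶜ :=
  (hΩ.isClosed_compl.notMem_iff_infDist_pos hne).1 fun h => h hζ

/-- The largest ball around a point of `Ω` is not contained in a compact subset of `Ω`. -/
theorem exists_mem_ball_infDist_compl_notMem (hΩ : IsOpen Ω) (hne : Ωᶜ.Nonempty)
    {ζ : EuclideanSpace ℂ (Fin n)} (hζ : ζ ∈ Ω) (hK : IsCompact K) (hKΩ : K ⊆ Ω) :
    ∃ z ∈ ball ζ (infDist ζ Ωᶜ), z ∉ K := by
  by_contra! h
  obtain ⟨p, hp, hpd⟩ := hΩ.isClosed_compl.exists_infDist_eq_dist hne ζ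
  let _ : NormedSpace ℝ (EuclideanSpace ℂ (Fin n)) := NormedSpace.restrictScalars ℝ ℂ _
  -- If `K` contained the ball, it would contain its closure, hence the nearest point `p` outside
  -- `Ω`.
  refine hp (hKΩ (closure_minimal h hK.isClosed ?_))
  rw [closure_ball _ (infDist_compl_pos hΩ hne hζ).ne', mem_closedBall, dist_comm, hpd]

/-- At a point of `Ω` outside the hull of `K` there are holomorphic functions
that are arbitrarily small on `K` and arbitrarily large at the point. -/
theorem exists_small_large_of_notMem_holomorphicHull (hK : IsCompact K) (hKΩ : K ⊆ Ω)
    {z : EuclideanSpace ℂ (Fin n)} (hz : z ∈ Ω) (hzK : z ∉ holomorphicHull Ω K) {ε R : ℝ}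
    (hε : 0 < ε) (hR : 0 < R) :
    ∃ g ∈ A Ω, (∀ y ∈ K, ‖g y‖ ≤ ε) ∧ ‖g z‖ = R := by
  obtain ⟨f, hf, hfz⟩ : ∃ f ∈ A Ω, sSup ((fun w => ‖f w‖) '' K) < ‖f z‖ := by
    by_contra! h
    exact hzK ⟨hz, h⟩
  set a := sSup ((fun w => ‖f w‖) '' K)
  have ha : 0 ≤ a := Real.sSup_nonneg (by rintro _ ⟨w, -, rfl⟩; exact norm_nonneg _)
  have hb : 0 < ‖f z‖ := ha.trans_lt hfz
  obtain ⟨N, hN⟩ := exists_pow_lt_of_lt_one (div_pos hε hR) ((div_lt_one hb).2 hfz)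
  -- The quotient has modulus at most `a / ‖f z‖ < 1` on `K` and equals `1` at `z`, so high powers
  -- separate the two.
  refine ⟨fun y => R * (f y / f z) ^ N, ?_, fun y hy => ?_, ?_⟩
  · have hf' : DifferentiableOn ℂ f Ω := hf
    exact ((hf'.mul_const (f z)⁻¹).pow N).const_mul _
  · have hya : ‖f y‖ ≤ a := le_csSup
      (hK.bddAbove_image ((DifferentiableOn.continuousOn hf).mono hKΩ).norm)
      (Set.mem_image_of_mem _ hy)
    rw [norm_mul, norm_pow, norm_div, Complex.norm_real, Real.norm_of_nonneg hR.le]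
    have h1 : (‖f y‖ / ‖f z‖) ^ N ≤ ε / R := by
      refine le_trans ?_ hN.le
      gcongr
    calc R * (‖f y‖ / ‖f z‖) ^ N ≤ R * (ε / R) := by gcongr
      _ = ε := mul_div_cancel₀ _ hR.ne'
  · simp only
    rw [div_self (norm_pos_iff.1 hb), one_pow, mul_one, Complex.norm_real,
      Real.norm_of_nonneg hR.le]

theorem exists_correction (hΩ : IsOpen Ω) (hne : Ωᶜ.Nonempty)
    (hull : ∀ K, IsCompact K → K ⊆ Ω → IsCompact (holomorphicHull Ω K))
    {ζ : EuclideanSpace ℂ (Fin n)} (hζ : ζ ∈ Ω) (hK : IsCompact K) (hKΩ : K ⊆ Ω)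
    {S : EuclideanSpace ℂ (Fin n) → ℂ} (hS : S ∈ A Ω) {ε : ℝ} (hε : 0 < ε) (R : ℝ) :
    ∃ z ∈ ball ζ (infDist ζ Ωᶜ), ∃ T ∈ A Ω, (∀ y ∈ K, ‖T y - S y‖ ≤ ε) ∧ R ≤ ‖T z‖ := by
  obtain ⟨z, hz, hzK⟩ := exists_mem_ball_infDist_compl_notMem hΩ hne hζ (hull K hK hKΩ)
    fun _ h => h.1
  obtain ⟨g, hg, hgK, hgz⟩ := exists_small_large_of_notMem_holomorphicHull hK hKΩ
    (ball_infDist_compl_subset hz) hzK hε (show 0 < |R| + 1 + ‖S z‖ by positivity)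
  refine ⟨z, hz, fun y => S y + g y, DifferentiableOn.add hS hg, by simpa using hgK, ?_⟩
  have := norm_sub_le (S z + g z) (S z)
  rw [add_sub_cancel_left, hgz] at this
  linarith [le_abs_self R]

theorem exists_compact_exhaustion (hΩ : IsOpen Ω) (hne : Ωᶜ.Nonempty) :
    ∃ L : ℕ → Set (EuclideanSpace ℂ (Fin n)), (∀ j, IsCompact (L j)) ∧ (∀ j, L j ⊆ Ω) ∧
      ∀ x ∈ Ω, ∃ r > 0, ∃ J, ∀ j, J ≤ j → ball x r ⊆ L j := by
  refine ⟨fun j => closedBall 0 j ∩ {z | 1 / ((j : ℝ) + 1) ≤ infDist z Ωᶜ}, fun j => ?_,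
    fun j z hz => ?_, fun x hx => ?_⟩
  · exact (isCompact_closedBall 0 _).inter_right
      (isClosed_le continuous_const (continuous_infDist_pt _))
  · by_contra hzΩ
    have h : 1 / ((j : ℝ) + 1) ≤ infDist z Ωᶜ := hz.2
    rw [infDist_zero_of_mem (s := Ωᶜ) hzΩ] at h
    exact h.not_gt (by positivity)
  · have hd := infDist_compl_pos hΩ hne hx
    refine ⟨infDist x Ωᶜ / 2, half_pos hd, ?_⟩
    obtain ⟨J₁, hJ₁⟩ := exists_nat_gt (‖x‖ + infDist x Ωᶜ / 2)
    obtain ⟨J₂, hJ₂⟩ := exists_nat_one_div_lt (half_pos hd)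
    refine ⟨max J₁ J₂, fun j hj y hy => ⟨?_, ?_⟩⟩
    · have h1 : (J₁ : ℝ) ≤ j := by exact_mod_cast (le_max_left _ _).trans hj
      rw [mem_ball, dist_eq_norm] at hy
      rw [mem_closedBall_zero_iff]
      linarith [norm_sub_norm_le y x]
    · have h2 : (J₂ : ℝ) ≤ j := by exact_mod_cast (le_max_right _ _).trans hj
      have h3 : 1 / ((j : ℝ) + 1) ≤ 1 / ((J₂ : ℝ) + 1) := by gcongr
      have h4 : infDist x Ωᶜ ≤ infDist y Ωᶜ + dist x y := infDist_le_infDist_add_dist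
      rw [mem_ball, dist_comm] at hy
      rw [Set.mem_ofPred_eq]
      linarith

/-- If hulls of compact sets are compact, some holomorphic function is unbounded on the largest
ball around each point of a given sequence. -/
theorem exists_unbounded_on_balls (hΩ : IsOpen Ω) (hne : Ωᶜ.Nonempty)
    (hull : ∀ K, IsCompact K → K ⊆ Ω → IsCompact (holomorphicHull Ω K))
    {ζ : ℕ → EuclideanSpace ℂ (Fin n)} (hζ : ∀ m, ζ m ∈ Ω) :
    ∃ f ∈ A Ω, ∀ (m : ℕ) (R : ℝ), ∃ z ∈ ball (ζ m) (infDist (ζ m) Ωᶜ), R ≤ ‖f z‖ := by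
  obtain ⟨L, hLc, hLΩ, hL⟩ := exists_compact_exhaustion hΩ hne
  -- The compact set stores the earlier peaks, so later corrections stay small there.
  let State := {p : Set (EuclideanSpace ℂ (Fin n)) × (EuclideanSpace ℂ (Fin n) → ℂ) //
    IsCompact p.1 ∧ p.1 ⊆ Ω ∧ p.2 ∈ A Ω}
  have step : ∀ (j : ℕ) (s : State), ∃ t : State, s.1.1 ∪ L j ⊆ t.1.1 ∧
      (∀ y ∈ s.1.1 ∪ L j, ‖t.1.2 y - s.1.2 y‖ ≤ (1 / 2) ^ j) ∧
      ∃ z ∈ ball (ζ j.unpair.1) (infDist (ζ j.unpair.1) Ωᶜ), z ∈ t.1.1 ∧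
        (j : ℝ) + 1 ≤ ‖t.1.2 z‖ := by
    rintro j ⟨⟨C, S⟩, hC, hCΩ, hS⟩
    obtain ⟨z, hz, T, hT, hTS, hTz⟩ := exists_correction hΩ hne hull (hζ j.unpair.1)
      (hC.union (hLc j)) (Set.union_subset hCΩ (hLΩ j)) hS
      (show (0 : ℝ) < (1 / 2) ^ j by positivity) (j + 1)
    exact ⟨⟨⟨insert z (C ∪ L j), T⟩, (hC.union (hLc j)).insert z,
      Set.insert_subset (ball_infDist_compl_subset hz) (Set.union_subset hCΩ (hLΩ j)), hT⟩,
      Set.subset_insert _ _, hTS, z, hz, Set.mem_insert _ _, hTz⟩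
  choose next hnext using step
  let s : ℕ → State := fun j => Nat.rec
    ⟨⟨∅, fun _ => 0⟩, isCompact_empty, Set.empty_subset _, differentiableOn_const 0⟩ next j
  have hs : ∀ j, s (j + 1) = next j (s j) := fun _ => rfl
  set S : ℕ → EuclideanSpace ℂ (Fin n) → ℂ := fun j => (s j).1.2 with hSdef
  have hmono : Monotone fun j => (s j).1.1 := monotone_nat_of_le_succ fun j =>
    Set.subset_union_left.trans (hnext j (s j)).1
  have hSA : ∀ j, DifferentiableOn ℂ (S j) Ω := fun j => (s j).2.2.2
  have hinc : ∀ j, ∀ y ∈ (s j).1.1 ∪ L j, ‖S (j + 1) y - S j y‖ ≤ (1 / 2) ^ j := fun j =>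
    (hnext j (s j)).2.1
  have hgeo : ∀ J, Summable fun k : ℕ => (1 / 2 : ℝ) ^ (k + J) := fun J =>
    (summable_nat_add_iff J).2 (summable_geometric_of_lt_one (by norm_num) (by norm_num))
  have hlim : ∀ y ∈ Ω, Tendsto (fun k => S k y) atTop
      (𝓝 (S 0 y + ∑' k, (S (k + 1) y - S k y))) := by
    intro y hy
    obtain ⟨r, hr, J, hJ⟩ := hL y hy
    have hsum : Summable fun k => S (k + 1) y - S k y := (summable_nat_add_iff J).1 <|
      .of_norm_bounded (hgeo J) fun k =>
        hinc _ y (Or.inr (hJ _ (Nat.le_add_left _ _) (mem_ball_self hr)))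
    have h := hsum.hasSum.tendsto_sum_nat.const_add (S 0 y)
    simpa only [Finset.sum_range_sub (fun k => S k y), add_sub_cancel] using h
  refine ⟨fun y => S 0 y + ∑' k, (S (k + 1) y - S k y), fun x hx => ?_, fun m R => ?_⟩
  · obtain ⟨r, hr, J, hJ⟩ := hL x hx
    have hrΩ : ball x r ⊆ Ω := (hJ J le_rfl).trans (hLΩ J)
    refine ((differentiableOn_of_tendsto_of_ball (f := fun k => S (k + J)) (hgeo J)
      (fun k => (hSA _).mono hrΩ) (fun k y hy => ?_)
      fun y hy => (tendsto_add_atTop_iff_nat J).2 (hlim y (hrΩ hy))).differentiableAt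
      (ball_mem_nhds x hr)).differentiableWithinAt
    rw [Nat.add_right_comm]
    exact hinc _ y (Or.inr (hJ _ (Nat.le_add_left _ _) hy))
  · obtain ⟨N, hN⟩ := exists_nat_ge R
    -- Pairing visits every centre `m` at stages `j ≥ N` for each `N`.
    set j := Nat.pair m N with hj
    obtain ⟨-, -, z, hz, hzC, hzj⟩ := hnext j (s j)
    rw [hj, Nat.unpair_pair] at hz
    refine ⟨z, hz, ?_⟩
    rw [← hs] at hzC hzj
    -- The peak starts at height `j + 1`, and all later corrections together cost at most `1`.
    have hind : ∀ i : ℕ, (j : ℝ) + (1 / 2) ^ i ≤ ‖S (i + (j + 1)) z‖ := by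
      intro i
      induction i with
      | zero => simpa [hSdef] using hzj
      | succ i ih =>
        have h1 := hinc (i + (j + 1)) z (Or.inl (hmono (Nat.le_add_left (j + 1) i) hzC))
        have h2 : (1 / 2 : ℝ) ^ (i + (j + 1)) ≤ (1 / 2) ^ (i + 1) :=
          pow_le_pow_of_le_one (by norm_num) (by norm_num) (by omega)
        have h3 : (1 / 2 : ℝ) ^ i = 2 * (1 / 2) ^ (i + 1) := by ring
        have h4 := norm_sub_norm_le (S (i + (j + 1)) z) (S (i + (j + 1) + 1) z)
        rw [norm_sub_rev] at h4
        rw [Nat.add_right_comm i 1]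
        linarith
    have hNj : (N : ℝ) ≤ j := by exact_mod_cast Nat.right_le_pair m N
    refine (hN.trans hNj).trans (ge_of_tendsto ((tendsto_add_atTop_iff_nat (j + 1)).2
      (hlim z (ball_infDist_compl_subset hz))).norm (.of_forall fun i => ?_))
    have : (0 : ℝ) ≤ (1 / 2) ^ i := by positivity
    linarith [hind i]

/-! ### Unboundedness excludes continuation -/

/-- A connected component of `Ω₂ ∩ Ω` accumulates at a point of `Ω₂` outside `Ω`. -/
theorem IsContinuationPair.exists_mem_closure {Ω₁ Ω₂ : Set (EuclideanSpace ℂ (Fin n))}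
    (hΩ : IsOpen Ω) (h : IsContinuationPair Ω Ω₁ Ω₂) {x : EuclideanSpace ℂ (Fin n)}
    (hx : x ∈ Ω₁) : ∃ p ∈ Ω₂, p ∉ Ω ∧ p ∈ closure (connectedComponentIn (Ω₂ ∩ Ω) x) := by
  by_contra! hcon
  have hopen : IsOpen (Ω₂ ∩ Ω) := h.isOpen_right.inter hΩ
  let _ : NormedSpace ℝ (EuclideanSpace ℂ (Fin n)) := NormedSpace.restrictScalars ℝ ℂ _
  have hxm := h.subset_inter hx
  -- Otherwise the component is relatively closed as well as open in the connected `Ω₂`, forcing `Ω₂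
  -- ⊆ Ω`.
  refine h.not_subset (Set.Subset.trans (h.isConnected.isPreconnected.subset_of_closure_inter_subset
    hopen.connectedComponentIn ⟨x, hxm.1, mem_connectedComponentIn hxm⟩ ?_)
    ((connectedComponentIn_subset _ x).trans Set.inter_subset_right))
  rintro p ⟨hp, hpΩ₂⟩
  have hpm : p ∈ Ω₂ ∩ Ω := ⟨hpΩ₂, by_contra fun hpΩ => hcon p hpΩ₂ hpΩ hp⟩
  obtain ⟨y, hyp, hyx⟩ := mem_closure_iff.1 hp _ hopen.connectedComponentIn
    (mem_connectedComponentIn hpm)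
  rw [connectedComponentIn_eq hyx, ← connectedComponentIn_eq hyp]
  exact mem_connectedComponentIn hpm

theorem not_continuable_of_unbounded_on_balls (hΩ : IsOpen Ω)
    {f : EuclideanSpace ℂ (Fin n) → ℂ} (hf : f ∈ A Ω) {ζ : ℕ → EuclideanSpace ℂ (Fin n)}
    (hdense : Ω ⊆ closure (Set.range ζ))
    (hunb : ∀ (m : ℕ) (R : ℝ), ∃ z ∈ ball (ζ m) (infDist (ζ m) Ωᶜ), R ≤ ‖f z‖) :
    ¬ ∃ Ω₁ Ω₂ : Set (EuclideanSpace ℂ (Fin n)), IsContinuationPair Ω Ω₁ Ω₂ ∧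
      ∃ f₂ ∈ A Ω₂, Set.EqOn f f₂ Ω₁ := by
  rintro ⟨Ω₁, Ω₂, h, f₂, hf₂, heq⟩
  obtain ⟨x, hx⟩ := h.nonempty
  obtain ⟨p, hpΩ₂, hpΩ, hp⟩ := h.exists_mem_closure hΩ hx
  let _ : NormedSpace ℝ (EuclideanSpace ℂ (Fin n)) := NormedSpace.restrictScalars ℝ ℂ _
  set V := connectedComponentIn (Ω₂ ∩ Ω) x with hV
  have hVopen : IsOpen V := (h.isOpen_right.inter hΩ).connectedComponentIn
  have hVsub : V ⊆ Ω₂ ∩ Ω := connectedComponentIn_subset _ x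
  have hEq : Set.EqOn f f₂ V := eqOn_of_isPreconnected hVopen isPreconnected_connectedComponentIn
    (DifferentiableOn.mono hf fun _ hz => (hVsub hz).2)
    (DifferentiableOn.mono hf₂ fun _ hz => (hVsub hz).1) h.isOpen_left
    ⟨x, hx, mem_connectedComponentIn (h.subset_inter hx)⟩ fun _ hz => heq hz.1
  obtain ⟨r, hr, hrsub⟩ : ∃ r > 0, ball p r ⊆ Ω₂ ∩ {z | ‖f₂ z‖ < ‖f₂ p‖ + 1} := by
    refine Metric.mem_nhds_iff.1 (inter_mem (h.isOpen_right.mem_nhds hpΩ₂) ?_)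
    exact ((DifferentiableOn.continuousOn hf₂).continuousAt
      (h.isOpen_right.mem_nhds hpΩ₂)).norm.eventually_lt continuousAt_const (lt_add_one _)
  obtain ⟨q, hqp, hqV⟩ := mem_closure_iff.1 hp (ball p (r / 2)) isOpen_ball
    (mem_ball_self (half_pos hr))
  obtain ⟨_, ⟨hζp, hζV⟩, m, rfl⟩ := mem_closure_iff.1 (hdense (hVsub hqV).2)
    (ball p (r / 2) ∩ V) (isOpen_ball.inter hVopen) ⟨hqp, hqV⟩
  have hd : infDist (ζ m) Ωᶜ < r / 2 :=
    (infDist_le_dist_of_mem (s := Ωᶜ) hpΩ).trans_lt (mem_ball.1 hζp)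
  have hsubp : ball (ζ m) (infDist (ζ m) Ωᶜ) ⊆ ball p r := fun y hy => by
    rw [mem_ball] at *
    linarith [dist_triangle y (ζ m) p]
  obtain ⟨z, hz, hzR⟩ := hunb m (‖f₂ p‖ + 1)
  -- The ball is connected, lies in `Ω₂ ∩ Ω` and meets `V`, so it stays in the component where `f =
  -- f₂`.
  have hzV : z ∈ V := by
    rw [hV, connectedComponentIn_eq hζV]
    have hsub : ball (ζ m) (infDist (ζ m) Ωᶜ) ⊆ Ω₂ ∩ Ω := fun y hy =>
      ⟨(hrsub (hsubp hy)).1, ball_infDist_compl_subset hy⟩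
    exact (convex_ball _ _).isPreconnected.subset_connectedComponentIn
      (mem_ball_self (pos_of_mem_ball hz)) hsub hz
  rw [hEq hzV] at hzR
  exact hzR.not_gt (hrsub (hsubp hz)).2

theorem exists_not_continuable (hΩ : IsOpen Ω)
    (hull : ∀ K, IsCompact K → K ⊆ Ω → IsCompact (holomorphicHull Ω K)) :
    ∃ f ∈ A Ω, ¬ ∃ Ω₁ Ω₂ : Set (EuclideanSpace ℂ (Fin n)), IsContinuationPair Ω Ω₁ Ω₂ ∧
      ∃ f₂ ∈ A Ω₂, Set.EqOn f f₂ Ω₁ := by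
  -- If `Ω` is empty or the whole space, no continuation pair exists. The whole space must be split
  -- off since `infDist` to the empty set is `0`.
  by_cases htriv : Ω.Nonempty ∧ Ωᶜ.Nonempty
  · obtain ⟨hΩne, hne⟩ := htriv
    have : Nonempty Ω := hΩne.to_subtype
    let ζ : ℕ → EuclideanSpace ℂ (Fin n) := fun m => TopologicalSpace.denseSeq Ω m
    obtain ⟨f, hf, hunb⟩ := exists_unbounded_on_balls hΩ hne hull (ζ := ζ) fun m => Subtype.prop _
    refine ⟨f, hf, not_continuable_of_unbounded_on_balls hΩ hf (fun x hx => ?_) hunb⟩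
    have h := image_closure_subset_closure_image continuous_subtype_val
      (Set.mem_image_of_mem Subtype.val (TopologicalSpace.denseRange_denseSeq Ω (⟨x, hx⟩ : Ω)))
    rwa [← Set.range_comp] at h
  · refine ⟨fun _ => 0, differentiableOn_const 0, ?_⟩
    rintro ⟨Ω₁, Ω₂, h, -⟩
    refine htriv ⟨h.nonempty.mono (h.subset_inter.trans Set.inter_subset_right), ?_⟩
    obtain ⟨p, -, hp⟩ := Set.not_subset.1 h.not_subset
    exact ⟨p, hp⟩

end CartanThullen

end SeveralComplexVariables

theorem theorem2p5p5 (n : ℕ) (Ω : Set (EuclideanSpace ℂ (Fin n))) (hΩ : IsOpen Ω) :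
    List.TFAE
      [ SeveralComplexVariables.IsDomainOfHolomorphy Ω,
        ∀ K : Set (EuclideanSpace ℂ (Fin n)), IsCompact K → K ⊆ Ω →
          IsCompact (SeveralComplexVariables.holomorphicHull Ω K) ∧
          SeveralComplexVariables.holomorphicHull Ω K ⊆ Ω ∧
          SeveralComplexVariables.boundaryDist Ω (SeveralComplexVariables.holomorphicHull Ω K) =
            SeveralComplexVariables.boundaryDist Ω K,
        ∀ K : Set (EuclideanSpace ℂ (Fin n)), IsCompact K → K ⊆ Ω →
          IsCompact (SeveralComplexVariables.holomorphicHull Ω K) ∧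
          SeveralComplexVariables.holomorphicHull Ω K ⊆ Ω,
        ∃ f ∈ SeveralComplexVariables.A Ω,
          ¬ ∃ Ω₁ Ω₂ : Set (EuclideanSpace ℂ (Fin n)),
            SeveralComplexVariables.IsContinuationPair Ω Ω₁ Ω₂ ∧
            ∃ f₂ ∈ SeveralComplexVariables.A Ω₂, Set.EqOn f f₂ Ω₁ ] := by
  tfae_have 1 → 2 := fun hD K hK hKΩ => ⟨SeveralComplexVariables.isCompact_holomorphicHull hD hK hKΩ,
    fun _ h => h.1,
    SeveralComplexVariables.boundaryDist_holomorphicHull hD hK hKΩ⟩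
  tfae_have 2 → 3 := fun h K hK hKΩ => ⟨(h K hK hKΩ).1, (h K hK hKΩ).2.1⟩
  tfae_have 3 → 4 := fun h => SeveralComplexVariables.exists_not_continuable hΩ
    fun K hK hKΩ => (h K hK hKΩ).1
  tfae_have 4 → 1 := by
    rintro ⟨f, hf, hcon⟩
    refine ⟨hΩ, ?_⟩
    rintro ⟨Ω₁, Ω₂, hpair, hext⟩
    exact hcon ⟨Ω₁, Ω₂, hpair, hext f hf⟩
  tfae_finish
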